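/- Matrices are real; for symmetric $X,Y\in\mathbb R^{n\times n}$, $X\succeq Y$ means that $X-Y$ is positive semidefinite, and $X\succ 0$ that $X$ is positive definite. A matrix is called stable if all its eigenvalues have negative real part. $\mathcal N(\cdot)$ denotes the null space. Let $A,Q,A_0^i\in\mathbb R^{n\times n}$, $B,L,B_0^i\in\mathbb R^{n\times m}$ $(1\le i\le r)$ and $R\in\mathbb R^{m\times m}$. For symmetric $X\in\mathbb R^{n\times n}$ put $$\Pi(X)=\begin{bmatrix}\Pi_{11}(X)&\Pi_{12}(X)\\ \Pi_{12}(X)^{T}&\Pi_{22}(X)\end{bmatrix}=\sum_{i=1}^r\begin{bmatrix}A_0^i&B_0^i\end{bmatrix}^{T}X\begin{bmatrix}A_0^i&B_0^i\end{bmatrix},$$ $L_c(X)=L+\Pi_{12}(X)$, $R_c(X)=R+\Pi_{22}(X)$, $Q_c(X)=Q+\Pi_{11}(X)$, $S(X)=XB+L_c(X)$, $$A_c(X)=A-BR_c(X)^{-1}L_c(X)^{T},\quad G_c(X)=BR_c(X)^{-1}B^{T},\quad H_c(X)=Q_c(X)-L_c(X)R_c(X)^{-1}L_c(X)^{T},$$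 $$\mathscr R(X)=A^{T}X+XA+Q+\Pi_{11}(X)-S(X)R_c(X)^{-1}S(X)^{T},\qquad \Omega(X)=\begin{bmatrix}-G_c(X)&-A_c(X)\\-A_c(X)^{T}&H_c(X)\end{bmatrix},$$ $$\mathscr F_W(Z)=V_W^{T}\,\Pi(Z)\,V_W,\quad V_W=\begin{bmatrix}-I\\R_c(W)^{-1}[L_c(W)+WB]^{T}\end{bmatrix},\qquad F_W(Y)=\begin{bmatrix}Y\\-I\end{bmatrix}^{T}\big[\Omega(Y)-\Omega(W)\big]\begin{bmatrix}Y\\-I\end{bmatrix}.$$ Standing hypotheses: 1. $R\succ0$ and $\begin{bmatrix}Q&L\\L^{T}&R\end{bmatrix}\succeq0$. 2. There is $F\in\mathbb R^{m\times n}$ such that the linear differential equation $\dot S=(A+BF)S+S(A+BF)^{T}+\sum_{i=1}^r(A_0^i+B_0^iF)S(A_0^i+B_0^iF)^{T}$ in symmetric matrices is exponentially stable, i.e. there are $c,\mu>0$ with $\|S(t)\|\le c\,e^{-\mu(t-t_0)}\|S(t_0)\|$ for all solutions $S$ and all $t\ge t_0$. 3. With $C$ a matrix such that $C^{T}C=Q-LR^{-1}L^{T}$,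 $\widetilde A=A-BR^{-1}L^{T}$ and $\widetilde A_0^i=A_0^i-B_0^iR^{-1}L^{T}$, there is a matrix $K$ such that $\dot S=(\widetilde A+KC)S+S(\widetilde A+KC)^{T}+\sum_{i=1}^r\widetilde A_0^iS(\widetilde A_0^i)^{T}$ is exponentially stable in the same sense. 4. $\mathcal N(Q-LR^{-1}L^{T})\subseteq\mathcal N(L^{T})\cap\bigcap_{i=1}^r\mathcal N(A_0^i)$. 5. $(A,B)$ is stabilizable ($A+BF$ is stable for some $F$) and $(Q-LR^{-1}L^{T},A)$ is detectable ($A+K(Q-LR^{-1}L^{T})$ is stable for some $K$). Let $X_*\succeq0$ be the positive semidefinite solution of $\mathscr R(X)=0$ (it is unique under these hypotheses), and suppose that there is $\alpha>0$ with $\mathscr F_{X_*}(Z)\succeq\alpha Z$ for all $Z\succeq0$. Let $X_0$ satisfy $0\preceq X_0\preceq X_*$, $\mathscr R(X_0)\succeq0$, and $$F_W(Y)-(Y-W)BR^{-1}B^{T}(Y-W)\succeq0\quad\text{for all } W,Y\text{ with } X_0\preceq W\preceq Y\preceq X_*.$$ Let $(X_k)_{k\ge0}$ be an infinite sequence generated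 from $X_0$ by the modified Newton method with exact steps: with $P_k=\begin{bmatrix}I\\-R_c(X_k)^{-1}S(X_k)^{T}\end{bmatrix}$ and $\widehat A_k=A-BR_c(X_k)^{-1}S(X_k)^{T}$, for every $k\ge 0$ the matrix $X_{k+1}$ solves the Lyapunov equation $$\widehat A_k^{T}X_{k+1}+X_{k+1}\widehat A_k+P_k^{T}\Pi(X_k)P_k+P_k^{T}\begin{bmatrix}Q&L\\L^{T}&R\end{bmatrix}P_k=0.$$ If $X_k\succeq0$ for all $k$, then (a) $0\preceq X_0\preceq X_1\preceq\cdots\preceq X_k\preceq X_*$ and $\mathscr R(X_k)\succeq0$ for all $k\ge0$; (b) $\lim_{k\to\infty}X_k=X_*$. -/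

import Mathlib

open Filter Topology
open scoped Matrix MatrixOrder

/-! With `MatrixOrder` open, `X ≤ Y` for real square matrices is the Loewner order:
`Y - X` is symmetric positive semidefinite. -/

/-- All eigenvalues (in `ℂ`) of the real matrix `M` have negative real part. -/
def IsHurwitz {n : ℕ} (M : Matrix (Fin n) (Fin n) ℝ) : Prop :=
  ∀ z ∈ spectrum ℂ (M.map (algebraMap ℝ ℂ)), z.re < 0

/-- `(A, B)` is stabilizable: some state feedback makes `A + B F` stable. -/
def IsStabilizablePair {n m : ℕ} (A : Matrix (Fin n) (Fin n) ℝ) (B : Matrix (Fin n) (Fin m) ℝ) :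
    Prop :=
  ∃ F : Matrix (Fin m) (Fin n) ℝ, IsHurwitz (A + B * F)

/-- `(C, A)` is detectable: some output injection makes `A + K C` stable. -/
def IsDetectablePair {n p : ℕ} (C : Matrix (Fin p) (Fin n) ℝ) (A : Matrix (Fin n) (Fin n) ℝ) :
    Prop :=
  ∃ K : Matrix (Fin n) (Fin p) ℝ, IsHurwitz (A + K * C)

section ExpStable
open scoped Matrix.Norms.Elementwise

/-- The linear differential equation `S' = Λ(S)` in the symmetric `n × n` matrices is exponentially
stable: `‖S(t)‖ ≤ c e^{-μ (t - t₀)} ‖S(t₀)‖` for all its solutions and all `t ≥ t₀`. (All norms on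
matrices are equivalent; the largest absolute value of an entry is used.) -/
def IsExpStable {n : ℕ} (Λ : Matrix (Fin n) (Fin n) ℝ → Matrix (Fin n) (Fin n) ℝ) : Prop :=
  ∃ c : ℝ, 0 < c ∧ ∃ μ : ℝ, 0 < μ ∧
    ∀ S : ℝ → Matrix (Fin n) (Fin n) ℝ,
      (∀ t, (S t).IsSymm) → (∀ t, HasDerivAt S (Λ (S t)) t) →
      ∀ t₀ t : ℝ, t₀ ≤ t → ‖S t‖ ≤ c * Real.exp (-μ * (t - t₀)) * ‖S t₀‖

end ExpStable

/-- The coefficient matrices of a stochastic continuous-time algebraic Riccati equation. -/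
structure SCARE (n m r : ℕ) where
  A : Matrix (Fin n) (Fin n) ℝ
  B : Matrix (Fin n) (Fin m) ℝ
  A₀ : Fin r → Matrix (Fin n) (Fin n) ℝ
  B₀ : Fin r → Matrix (Fin n) (Fin m) ℝ
  Q : Matrix (Fin n) (Fin n) ℝ
  L : Matrix (Fin n) (Fin m) ℝ
  R : Matrix (Fin m) (Fin m) ℝ

namespace SCARE

variable {n m r : ℕ} (E : SCARE n m r)

def Pi11 (X : Matrix (Fin n) (Fin n) ℝ) : Matrix (Fin n) (Fin n) ℝ :=
  ∑ i, (E.A₀ i)ᵀ * X * E.A₀ i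

def Pi12 (X : Matrix (Fin n) (Fin n) ℝ) : Matrix (Fin n) (Fin m) ℝ :=
  ∑ i, (E.A₀ i)ᵀ * X * E.B₀ i

def Pi21 (X : Matrix (Fin n) (Fin n) ℝ) : Matrix (Fin m) (Fin n) ℝ :=
  ∑ i, (E.B₀ i)ᵀ * X * E.A₀ i

def Pi22 (X : Matrix (Fin n) (Fin n) ℝ) : Matrix (Fin m) (Fin m) ℝ :=
  ∑ i, (E.B₀ i)ᵀ * X * E.B₀ i

/-- The block matrix `Π(X)`. -/
def Pi (X : Matrix (Fin n) (Fin n) ℝ) : Matrix (Fin n ⊕ Fin m) (Fin n ⊕ Fin m) ℝ :=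
  Matrix.fromBlocks (E.Pi11 X) (E.Pi12 X) (E.Pi21 X) (E.Pi22 X)

/-- `L_c(X)`. -/
def Lc (X : Matrix (Fin n) (Fin n) ℝ) : Matrix (Fin n) (Fin m) ℝ := E.L + E.Pi12 X

/-- `R_c(X)`. -/
def Rc (X : Matrix (Fin n) (Fin n) ℝ) : Matrix (Fin m) (Fin m) ℝ := E.R + E.Pi22 X

/-- `Q_c(X)`. -/
def Qc (X : Matrix (Fin n) (Fin n) ℝ) : Matrix (Fin n) (Fin n) ℝ := E.Q + E.Pi11 X

/-- `S(X) = X B + L_c(X)`. -/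
def Sc (X : Matrix (Fin n) (Fin n) ℝ) : Matrix (Fin n) (Fin m) ℝ := X * E.B + E.Lc X

/-- `A_c(X)`. -/
noncomputable def Ac (X : Matrix (Fin n) (Fin n) ℝ) : Matrix (Fin n) (Fin n) ℝ :=
  E.A - E.B * (E.Rc X)⁻¹ * (E.Lc X)ᵀ

/-- `G_c(X)`. -/
noncomputable def Gc (X : Matrix (Fin n) (Fin n) ℝ) : Matrix (Fin n) (Fin n) ℝ :=
  E.B * (E.Rc X)⁻¹ * E.Bᵀ

/-- `H_c(X)`. -/
noncomputable def Hc (X : Matrix (Fin n) (Fin n) ℝ) : Matrix (Fin n) (Fin n) ℝ :=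
  E.Qc X - E.Lc X * (E.Rc X)⁻¹ * (E.Lc X)ᵀ

/-- The Riccati function `ℛ(X)`. -/
noncomputable def riccati (X : Matrix (Fin n) (Fin n) ℝ) : Matrix (Fin n) (Fin n) ℝ :=
  E.Aᵀ * X + X * E.A + E.Q + E.Pi11 X - E.Sc X * (E.Rc X)⁻¹ * (E.Sc X)ᵀ

/-- The block matrix `Ω(X)`. -/
noncomputable def Omega (X : Matrix (Fin n) (Fin n) ℝ) :
    Matrix (Fin n ⊕ Fin n) (Fin n ⊕ Fin n) ℝ :=
  Matrix.fromBlocks (-E.Gc X) (-E.Ac X) (-(E.Ac X)ᵀ) (E.Hc X)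

/-- `F_W(Y) = [Y; -I]ᵀ (Ω(Y) - Ω(W)) [Y; -I]`. -/
noncomputable def bigF (W Y : Matrix (Fin n) (Fin n) ℝ) : Matrix (Fin n) (Fin n) ℝ :=
  (Matrix.fromRows Y (-1 : Matrix (Fin n) (Fin n) ℝ))ᵀ * (E.Omega Y - E.Omega W) *
    Matrix.fromRows Y (-1 : Matrix (Fin n) (Fin n) ℝ)

/-- The linear operator `𝓕_W(Z) = Vᵀ Π(Z) V` with `V = [-I; R_c(W)⁻¹ (L_c(W) + W B)ᵀ]`. -/
noncomputable def scrF (W Z : Matrix (Fin n) (Fin n) ℝ) : Matrix (Fin n) (Fin n) ℝ :=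
  (Matrix.fromRows (-1 : Matrix (Fin n) (Fin n) ℝ) ((E.Rc W)⁻¹ * (E.Lc W + W * E.B)ᵀ))ᵀ *
    E.Pi Z *
    Matrix.fromRows (-1 : Matrix (Fin n) (Fin n) ℝ) ((E.Rc W)⁻¹ * (E.Lc W + W * E.B)ᵀ)

/-- The stochastic pair `({A₀ⁱ}, {B₀ⁱ})`, `i = 0, …, r`, with `A₀⁰ = A` and `B₀⁰ = B`, is
stabilizable. -/
def StochStabilizable : Prop :=
  ∃ F : Matrix (Fin m) (Fin n) ℝ,
    IsExpStable fun S => (E.A + E.B * F) * S + S * (E.A + E.B * F)ᵀ +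
      ∑ i, (E.A₀ i + E.B₀ i * F) * S * (E.A₀ i + E.B₀ i * F)ᵀ

/-- `Ã = A - B R⁻¹ Lᵀ`. -/
noncomputable def tildeA : Matrix (Fin n) (Fin n) ℝ := E.A - E.B * E.R⁻¹ * E.Lᵀ

/-- `Ã₀ⁱ = A₀ⁱ - B₀ⁱ R⁻¹ Lᵀ` for `i = 1, …, r`. -/
noncomputable def tildeA₀ (i : Fin r) : Matrix (Fin n) (Fin n) ℝ :=
  E.A₀ i - E.B₀ i * E.R⁻¹ * E.Lᵀ

/-- The stochastic pair `(C, {Ã₀ⁱ})` is detectable, where `Cᵀ C = Q - L R⁻¹ Lᵀ`. The property does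
not depend on the choice of such a `C`. -/
def StochDetectable : Prop :=
  ∃ (p : ℕ) (C : Matrix (Fin p) (Fin n) ℝ), Cᵀ * C = E.Q - E.L * E.R⁻¹ * E.Lᵀ ∧
    ∃ K : Matrix (Fin n) (Fin p) ℝ,
      IsExpStable fun S => (E.tildeA + K * C) * S + S * (E.tildeA + K * C)ᵀ +
        ∑ i, E.tildeA₀ i * S * (E.tildeA₀ i)ᵀ

/-- The standing assumptions on the coefficients. -/
structure Standing : Prop where
  stochStabilizable : E.StochStabilizable
  stochDetectable : E.StochDetectable
  posDef_R : E.R.PosDef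
  posSemidef_cost : (Matrix.fromBlocks E.Q E.L E.Lᵀ E.R).PosSemidef
  /-- `𝒩(Q - L R⁻¹ Lᵀ) ⊆ 𝒩(Lᵀ) ∩ ⋂ᵢ 𝒩(A₀ⁱ)`. -/
  ker_subset : ∀ v : Fin n → ℝ, (E.Q - E.L * E.R⁻¹ * E.Lᵀ) *ᵥ v = 0 →
    E.Lᵀ *ᵥ v = 0 ∧ ∀ i, E.A₀ i *ᵥ v = 0
  stabilizable : IsStabilizablePair E.A E.B
  detectable : IsDetectablePair (E.Q - E.L * E.R⁻¹ * E.Lᵀ) E.A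

/-- `X` is a positive semidefinite solution of `ℛ(X) = 0`. -/
def IsPSDSolution (X : Matrix (Fin n) (Fin n) ℝ) : Prop :=
  0 ≤ X ∧ E.riccati X = 0

/-- `P(X) = [I; -R_c(X)⁻¹ S(X)ᵀ]`. -/
noncomputable def Pc (X : Matrix (Fin n) (Fin n) ℝ) : Matrix (Fin n ⊕ Fin m) (Fin n) ℝ :=
  Matrix.fromRows (1 : Matrix (Fin n) (Fin n) ℝ) (-((E.Rc X)⁻¹ * (E.Sc X)ᵀ))

/-- `Â(X) = A - B R_c(X)⁻¹ S(X)ᵀ`. -/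
noncomputable def hatA (X : Matrix (Fin n) (Fin n) ℝ) : Matrix (Fin n) (Fin n) ℝ :=
  E.A - E.B * (E.Rc X)⁻¹ * (E.Sc X)ᵀ

/-- `X'` is an (exact) modified Newton iterate following `X`: it solves the Lyapunov equation
`Âᵀ X' + X' Â + Pᵀ Π(X) P + M = 0`, where `M = Pᵀ [Q, L; Lᵀ, R] P` and `Â`, `P` are taken at `X`. -/
def IsModifiedNewtonStep (X X' : Matrix (Fin n) (Fin n) ℝ) : Prop :=
  (E.hatA X)ᵀ * X' + X' * E.hatA X + (E.Pc X)ᵀ * E.Pi X * E.Pc X +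
    (E.Pc X)ᵀ * Matrix.fromBlocks E.Q E.L E.Lᵀ E.R * E.Pc X = 0

end SCARE

/-! Write `Δ = Y - W`. The expansion `bigF_eq` of `ℛ` at `W` has the remainder `F_W(Y) - Δ G_c(W)
Δ`. The closeness hypothesis, together with `R_c(W)⁻¹ ≤ R⁻¹`, makes it nonnegative, so `ℛ` dominates
its modified linearization (`riccati_add_lyap_le`). The Newton correction `X (k + 1) - X k`
annihilates that linearization at `X k`, which gives `ℛ (X (k + 1)) ≥ 0`; taking `Y = Xs` gives the
upper bound.

Turning these inequalities into order statements needs a comparison principle: if the Lyapunov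
operator is stable and maps `D` to a positive semidefinite matrix, then `D ≤ 0`
(`LyapStable.nonpos_of_lyap_nonneg`). Stability here means that some `Z > 0` is mapped to a negative
definite matrix. Hurwitz and exponential stability both yield such a `Z`, since both exclude
nonnegative real eigenvalues. Detectability carries it to the closed loops through Finsler's lemma
(`LyapStable.of_detectable`).

The monotone bounded iterates converge to a solution of `ℛ = 0` below `Xs`. Positive semidefinite
solutions are stochastically stabilizing, so comparison forces two ordered ones to coincide
(`IsPSDSolution.eq_of_le`). -/

namespace Matrix

/-! ### Real quadratic forms and Finsler's lemma -/

variable {n ι : Type*} [Fintype n] [Fintype ι]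

theorem posSemidef_real_iff {Z : Matrix n n ℝ} :
    Z.PosSemidef ↔ Zᵀ = Z ∧ ∀ v : n → ℝ, 0 ≤ v ⬝ᵥ Z *ᵥ v := by
  rw [posSemidef_iff_dotProduct_mulVec]
  simp [IsHermitian]

theorem posDef_real_iff {Z : Matrix n n ℝ} :
    Z.PosDef ↔ Zᵀ = Z ∧ ∀ v : n → ℝ, v ≠ 0 → 0 < v ⬝ᵥ Z *ᵥ v := by
  rw [posDef_iff_dotProduct_mulVec]
  simp [IsHermitian]

theorem dotProduct_transpose_mulVec' (M : Matrix n n ℝ) (v w : n → ℝ) :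
    v ⬝ᵥ Mᵀ *ᵥ w = (M *ᵥ v) ⬝ᵥ w := by
  rw [mulVec_transpose, dotProduct_comm, ← dotProduct_mulVec, dotProduct_comm]

theorem continuous_quadraticForm (Z : Matrix n n ℝ) :
    Continuous fun v : n → ℝ => v ⬝ᵥ Z *ᵥ v := by
  simp only [dotProduct, mulVec]
  fun_prop

theorem quadraticForm_smul (Z : Matrix n n ℝ) (a : ℝ) (v : n → ℝ) :
    (a • v) ⬝ᵥ Z *ᵥ (a • v) = a ^ 2 * (v ⬝ᵥ Z *ᵥ v) := by
  simp only [mulVec_smul, dotProduct_smul, smul_dotProduct, smul_eq_mul]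
  ring

theorem exists_sphere_smul (v : n → ℝ) (hv : v ≠ 0) :
    ∃ w ∈ Metric.sphere (0 : n → ℝ) 1, v = ‖v‖ • w := by
  have h : ‖v‖ ≠ 0 := norm_ne_zero_iff.2 hv
  refine ⟨‖v‖⁻¹ • v, ?_, ?_⟩
  · simp [norm_smul, h]
  · rw [smul_smul, mul_inv_cancel₀ h, one_smul]

/-- **Finsler's lemma**. -/
theorem exists_quadraticForm_sub_neg {N H : Matrix n n ℝ} (hH : H.PosSemidef)
    (h : ∀ v, v ≠ 0 → H *ᵥ v = 0 → v ⬝ᵥ N *ᵥ v < 0) :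
    ∃ k : ℝ, 0 < k ∧ ∀ v, v ≠ 0 → v ⬝ᵥ N *ᵥ v < k * (v ⬝ᵥ H *ᵥ v) := by
  have hH0 := (posSemidef_real_iff.1 hH).2
  -- Only unit vectors with a nonnegative `N`-form matter. On this compact set the `H`-form has a
  -- positive minimum, so `k` can be the maximum of the `N`-form, plus one for strictness, over that
  -- minimum.
  let K : Set (n → ℝ) := Metric.sphere 0 1 ∩ {v | 0 ≤ v ⬝ᵥ N *ᵥ v}
  have hK : IsCompact K := (isCompact_sphere 0 1).inter_right
    (isClosed_le continuous_const (continuous_quadraticForm N))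
  suffices ∃ k : ℝ, 0 < k ∧ ∀ v ∈ K, v ⬝ᵥ N *ᵥ v < k * (v ⬝ᵥ H *ᵥ v) by
    obtain ⟨k, hk, hkv⟩ := this
    refine ⟨k, hk, fun v hv => ?_⟩
    obtain ⟨w, hw, hvw⟩ := exists_sphere_smul v hv
    have hpos : 0 < ‖v‖ ^ 2 := by positivity
    have hwk : w ⬝ᵥ N *ᵥ w < k * (w ⬝ᵥ H *ᵥ w) := by
      by_cases hN : 0 ≤ w ⬝ᵥ N *ᵥ w
      · exact hkv w ⟨hw, hN⟩
      · exact (not_le.1 hN).trans_le (mul_nonneg hk.le (hH0 w))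
    rw [hvw, quadraticForm_smul, quadraticForm_smul]
    nlinarith
  rcases K.eq_empty_or_nonempty with hE | hne
  · exact ⟨1, one_pos, by simp [hE]⟩
  obtain ⟨a, haK, ha⟩ := hK.exists_isMinOn hne (continuous_quadraticForm H).continuousOn
  obtain ⟨b, hbK, hb⟩ := hK.exists_isMaxOn hne (continuous_quadraticForm N).continuousOn
  have hHa : 0 < a ⬝ᵥ H *ᵥ a := by
    refine lt_of_le_of_ne (hH0 a) fun h0 => ?_
    have ha0 : a ≠ 0 := by
      rintro rfl
      simpa using haK.1
    have := h a ha0 ((hH.dotProduct_mulVec_zero_iff a).1 (by simpa using h0.symm))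
    exact absurd haK.2 (not_le.2 this)
  have hNb : 0 ≤ b ⬝ᵥ N *ᵥ b := hbK.2
  refine ⟨(b ⬝ᵥ N *ᵥ b + 1) / (a ⬝ᵥ H *ᵥ a), by positivity, fun v hv => ?_⟩
  have h1 : v ⬝ᵥ N *ᵥ v ≤ b ⬝ᵥ N *ᵥ b := hb hv
  have h2 : a ⬝ᵥ H *ᵥ a ≤ v ⬝ᵥ H *ᵥ v := ha hv
  calc v ⬝ᵥ N *ᵥ v < b ⬝ᵥ N *ᵥ b + 1 := by linarith
    _ = (b ⬝ᵥ N *ᵥ b + 1) / (a ⬝ᵥ H *ᵥ a) * (a ⬝ᵥ H *ᵥ a) := by field_simp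
    _ ≤ _ := by gcongr

/-! ### Generalized Lyapunov operators and the comparison principle -/

variable [DecidableEq n]

theorem exists_quadraticForm_lt (N : Matrix n n ℝ) :
    ∃ k : ℝ, 0 < k ∧ ∀ v, v ≠ 0 → v ⬝ᵥ N *ᵥ v < k * (v ⬝ᵥ v) := by
  simpa using exists_quadraticForm_sub_neg (N := N) (H := 1) PosSemidef.one
    (fun v hv h => absurd (by simpa using h) hv)

/-- The generalized Lyapunov operator `Z ↦ Mᵀ Z + Z M + ∑ᵢ (N i)ᵀ Z (N i)`. -/
def lyap (M : Matrix n n ℝ) (N : ι → Matrix n n ℝ) : Matrix n n ℝ →ₗ[ℝ] Matrix n n ℝ where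
  toFun Z := Mᵀ * Z + Z * M + ∑ i, (N i)ᵀ * Z * N i
  map_add' X Y := by
    simp only [Matrix.mul_add, Matrix.add_mul, Finset.sum_add_distrib]
    abel
  map_smul' a X := by
    simp [Finset.smul_sum]

variable {M M' : Matrix n n ℝ} {N N' : ι → Matrix n n ℝ}

theorem lyap_apply (M : Matrix n n ℝ) (N : ι → Matrix n n ℝ) (Z : Matrix n n ℝ) :
    lyap M N Z = Mᵀ * Z + Z * M + ∑ i, (N i)ᵀ * Z * N i := rfl

theorem transpose_lyap (Z : Matrix n n ℝ) : (lyap M N Z)ᵀ = lyap M N Zᵀ := by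
  simp only [lyap_apply, transpose_add, transpose_mul, transpose_sum, transpose_transpose,
    Matrix.mul_assoc]
  abel

theorem trace_lyap_mul (Z S : Matrix n n ℝ) :
    (lyap M N Z * S).trace = (Z * lyap Mᵀ (fun i => (N i)ᵀ) S).trace := by
  have h (P : Matrix n n ℝ) : (Pᵀ * Z * P * S).trace = (Z * (P * S * Pᵀ)).trace := by
    rw [Matrix.mul_assoc, Matrix.mul_assoc, trace_mul_comm]
    simp only [Matrix.mul_assoc]
  have h1 : (Mᵀ * Z * S).trace = (Z * (S * Mᵀ)).trace := by
    rw [Matrix.mul_assoc, trace_mul_comm, Matrix.mul_assoc]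
  simp only [lyap_apply, Matrix.add_mul, Matrix.mul_add, Finset.sum_mul, Finset.mul_sum,
    trace_add, trace_sum, transpose_transpose, h, h1]
  simp only [Matrix.mul_assoc]
  abel

/-- Shifting `M` by a scalar shifts the whole operator; this is the homotopy parameter in
`NoNonnegEigenvalue.lyapStable`. -/
theorem lyap_sub_smul_one (a : ℝ) (Z : Matrix n n ℝ) :
    lyap (M - (a / 2) • 1) N Z = lyap M N Z - a • Z := by
  have : a • Z = (a / 2) • Z + (a / 2) • Z := by rw [← add_smul]; ring_nf
  simp only [lyap_apply, transpose_sub, transpose_smul, transpose_one, Matrix.sub_mul,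
    Matrix.mul_sub, Matrix.smul_mul, Matrix.mul_smul, Matrix.one_mul, Matrix.mul_one, this]
  abel

theorem quadraticForm_lyap (Z : Matrix n n ℝ) (v : n → ℝ) :
    v ⬝ᵥ lyap M N Z *ᵥ v = (M *ᵥ v) ⬝ᵥ Z *ᵥ v + v ⬝ᵥ Z *ᵥ (M *ᵥ v) +
      ∑ i, (N i *ᵥ v) ⬝ᵥ Z *ᵥ (N i *ᵥ v) := by
  simp only [lyap_apply, add_mulVec, sum_mulVec, dotProduct_add, dotProduct_sum, ← mulVec_mulVec,
    dotProduct_transpose_mulVec']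

theorem quadraticForm_lyap_nonneg_of_mulVec_eq_zero {Z : Matrix n n ℝ} (hZ : Z.PosSemidef)
    {v : n → ℝ} (hv : Z *ᵥ v = 0) : 0 ≤ v ⬝ᵥ lyap M N Z *ᵥ v := by
  rw [posSemidef_real_iff] at hZ
  have h : v ⬝ᵥ Z *ᵥ (M *ᵥ v) = 0 := by
    rw [← hZ.1, dotProduct_transpose_mulVec', hv, zero_dotProduct]
  rw [quadraticForm_lyap, hv, dotProduct_zero, h]
  simpa using Finset.sum_nonneg fun i _ => hZ.2 (N i *ᵥ v)

variable (M N) in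
/-- The generalized Lyapunov operator admits a positive definite strict Lyapunov matrix. -/
def LyapStable : Prop := ∃ Z : Matrix n n ℝ, Z.PosDef ∧ (-lyap M N Z).PosDef

theorem posDef_of_lyap_neg {Z : Matrix n n ℝ} (hZ : Z.PosSemidef) (h : (-lyap M N Z).PosDef) :
    Z.PosDef := by
  refine posDef_real_iff.2 ⟨(posSemidef_real_iff.1 hZ).1, fun v hv => ?_⟩
  refine lt_of_le_of_ne ((posSemidef_real_iff.1 hZ).2 v) fun h0 => ?_
  have h1 := quadraticForm_lyap_nonneg_of_mulVec_eq_zero (M := M) (N := N) hZ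
    ((hZ.dotProduct_mulVec_zero_iff v).1 (by simpa using h0.symm))
  have h2 := (posDef_real_iff.1 h).2 v hv
  rw [neg_mulVec, dotProduct_neg] at h2
  linarith

/-- Let `t` be the maximum of the quotient of the `D`-form by the `Z`-form. If `t > 0`, then `t • Z
- D` is positive semidefinite with a kernel vector `w`. At `w` its Lyapunov image has a nonnegative
form, but `t • lyap Z` contributes a negative amount and `-lyap D` a nonpositive one. -/
theorem LyapStable.nonpos_of_lyap_nonneg (hMN : LyapStable M N) {D : Matrix n n ℝ}
    (hD : Dᵀ = D) (h : (lyap M N D).PosSemidef) : (-D).PosSemidef := by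
  obtain ⟨Z, hZ, hLZ⟩ := hMN
  rw [posDef_real_iff] at hZ hLZ
  rw [posSemidef_real_iff] at h
  refine posSemidef_real_iff.2 ⟨by rw [transpose_neg, hD], fun u => ?_⟩
  by_contra! hu
  rw [neg_mulVec, dotProduct_neg, neg_lt_zero] at hu
  have hu0 : u ≠ 0 := by rintro rfl; simp at hu
  obtain ⟨u', hu', huu⟩ := exists_sphere_smul u hu0
  have hne {v : n → ℝ} (hv : v ∈ Metric.sphere (0 : n → ℝ) 1) : v ≠ 0 := by
    rintro rfl; simp at hv
  obtain ⟨w, hw, hmax⟩ := (isCompact_sphere (0 : n → ℝ) 1).exists_isMaxOn ⟨u', hu'⟩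
    (f := fun v => (v ⬝ᵥ D *ᵥ v) / (v ⬝ᵥ Z *ᵥ v))
    ((continuous_quadraticForm D).continuousOn.div (continuous_quadraticForm Z).continuousOn
      fun v hv => (hZ.2 v (hne hv)).ne')
  set t := (w ⬝ᵥ D *ᵥ w) / (w ⬝ᵥ Z *ᵥ w) with ht
  have ht0 : 0 < t := by
    refine lt_of_lt_of_le ?_ (hmax hu')
    rw [huu, quadraticForm_smul] at hu
    exact div_pos (by nlinarith [sq_nonneg ‖u‖]) (hZ.2 _ (hne hu'))
  have hq (v : n → ℝ) : v ⬝ᵥ (t • Z - D) *ᵥ v = t * (v ⬝ᵥ Z *ᵥ v) - v ⬝ᵥ D *ᵥ v := by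
    simp [sub_mulVec, smul_mulVec, dotProduct_sub]
  have hW : (t • Z - D).PosSemidef := by
    refine posSemidef_real_iff.2 ⟨by simp [hZ.1, hD], fun v => ?_⟩
    rcases eq_or_ne v 0 with rfl | hv
    · simp
    obtain ⟨v', hv', hvv⟩ := exists_sphere_smul v hv
    have h1 : (v' ⬝ᵥ D *ᵥ v') / (v' ⬝ᵥ Z *ᵥ v') ≤ t := hmax hv'
    rw [div_le_iff₀ (hZ.2 _ (hne hv'))] at h1
    rw [hvv, quadraticForm_smul, hq]
    have := sq_nonneg ‖v‖
    exact mul_nonneg this (by linarith)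
  have hker : (t • Z - D) *ᵥ w = 0 := by
    refine (hW.dotProduct_mulVec_zero_iff w).1 ?_
    rw [star_trivial, hq, ht, div_mul_cancel₀ _ (hZ.2 w (hne hw)).ne', sub_self]
  have h1 := quadraticForm_lyap_nonneg_of_mulVec_eq_zero (M := M) (N := N) hW hker
  have h2 := hLZ.2 w (hne hw)
  have h3 := h.2 w
  rw [map_sub, map_smul, sub_mulVec, smul_mulVec, dotProduct_sub, dotProduct_smul,
    smul_eq_mul] at h1
  rw [neg_mulVec, dotProduct_neg] at h2
  nlinarith

/-- Detectability transfers stability along a positive semidefinite Lyapunov matrix. -/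
theorem LyapStable.of_detectable {X H : Matrix n n ℝ} (hX : X.PosSemidef) (hH : H.PosSemidef)
    (hXH : (-H - lyap M N X).PosSemidef) (hM' : LyapStable M' N')
    (h : ∀ v, H *ᵥ v = 0 → M *ᵥ v = M' *ᵥ v ∧ ∀ i, N i *ᵥ v = N' i *ᵥ v) :
    LyapStable M N := by
  obtain ⟨Z, hZ, hLZ⟩ := hM'
  obtain ⟨k, hk, hkv⟩ := exists_quadraticForm_sub_neg (N := lyap M N Z) hH fun v hv hHv => by
    obtain ⟨h1, h2⟩ := h v hHv
    have h3 := (posDef_real_iff.1 hLZ).2 v hv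
    rw [neg_mulVec, dotProduct_neg, quadraticForm_lyap] at h3
    rw [quadraticForm_lyap, h1]
    simp only [h2]
    linarith
  have hZs := (posDef_real_iff.1 hZ).1
  have hXs := (posSemidef_real_iff.1 hX).1
  -- Finsler gives `lyap Z < k H`, while `lyap X ≤ -H`; the `H` terms cancel in the sum.
  refine ⟨Z + k • X, hZ.add_posSemidef (hX.smul hk.le), posDef_real_iff.2 ⟨?_, fun v hv => ?_⟩⟩
  · rw [transpose_neg, transpose_lyap, transpose_add, transpose_smul, hZs, hXs]
  · have h1 := (posSemidef_real_iff.1 hXH).2 v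
    have h2 := hkv v hv
    rw [sub_mulVec, neg_mulVec, dotProduct_sub, dotProduct_neg] at h1
    rw [neg_mulVec, dotProduct_neg, map_add, map_smul, add_mulVec, smul_mulVec, dotProduct_add,
      dotProduct_smul, smul_eq_mul]
    nlinarith

/-! ### From excluded eigenvalues to a Lyapunov matrix -/

variable (M N) in
/-- The generalized Lyapunov equation `S' = M S + S Mᵀ + ∑ᵢ N i S (N i)ᵀ` has no nonzero symmetric
eigenvector with a nonnegative real eigenvalue. -/
def NoNonnegEigenvalue : Prop :=
  ∀ a : ℝ, 0 ≤ a → ∀ S : Matrix n n ℝ, Sᵀ = S → lyap Mᵀ (fun i => (N i)ᵀ) S = a • S → S = 0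

variable (n) in
/-- The space of real symmetric matrices. -/
def symmSubmodule : Submodule ℝ (Matrix n n ℝ) where
  carrier := {S | Sᵀ = S}
  add_mem' {a b} ha hb := by
    rw [Set.mem_ofPred_eq] at ha hb ⊢
    rw [transpose_add, ha, hb]
  zero_mem' := transpose_zero
  smul_mem' c x hx := by
    rw [Set.mem_ofPred_eq] at hx ⊢
    rw [transpose_smul, hx]

variable (M N) in
/-- The operator `a - lyap M N` on symmetric matrices. -/
def lyapResolvent (a : ℝ) : symmSubmodule n →ₗ[ℝ] symmSubmodule n :=
  (a • LinearMap.id - lyap M N).restrict fun S (hS : Sᵀ = S) => by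
    change (a • S - lyap M N S)ᵀ = a • S - lyap M N S
    rw [transpose_sub, transpose_smul, transpose_lyap, hS]

theorem coe_lyapResolvent (a : ℝ) (S : symmSubmodule n) :
    (lyapResolvent M N a S : Matrix n n ℝ) = a • (S : Matrix n n ℝ) - lyap M N S := rfl

/-- The hypothesis makes the trace-adjoint of `a - lyap M N` injective on symmetric matrices, hence
surjective. A kernel element `D` of the operator itself is then orthogonal to everything, including
`D`. -/
theorem NoNonnegEigenvalue.exists_smul_sub_lyap_eq_one (h : NoNonnegEigenvalue M N) {a : ℝ}
    (ha : 0 ≤ a) : ∃ Z : Matrix n n ℝ, Zᵀ = Z ∧ a • Z - lyap M N Z = 1 := by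
  have hdual : Function.Surjective (lyapResolvent Mᵀ (fun i => (N i)ᵀ) a) := by
    rw [← LinearMap.injective_iff_surjective, injective_iff_map_eq_zero]
    intro S hS
    have := congrArg Subtype.val hS
    rw [coe_lyapResolvent, ZeroMemClass.coe_zero, sub_eq_zero] at this
    exact Subtype.ext (h a ha S S.2 this.symm)
  have hsurj : Function.Surjective (lyapResolvent M N a) := by
    rw [← LinearMap.injective_iff_surjective, injective_iff_map_eq_zero]
    intro D hD
    obtain ⟨S, hS⟩ := hdual D
    have hD' := congrArg Subtype.val hD
    have hS' := congrArg Subtype.val hS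
    rw [coe_lyapResolvent] at hD' hS'
    have htr : ((D : Matrix n n ℝ) * D).trace = 0 := by
      calc ((D : Matrix n n ℝ) * D).trace
          = ((D : Matrix n n ℝ) * (a • (S : Matrix n n ℝ) - lyap Mᵀ (fun i => (N i)ᵀ) S)).trace := by
            rw [hS']
        _ = ((a • (D : Matrix n n ℝ) - lyap M N D) * S).trace := by
            rw [Matrix.mul_sub, Matrix.sub_mul, trace_sub, trace_sub, trace_lyap_mul,
              Matrix.mul_smul, Matrix.smul_mul]
        _ = 0 := by rw [hD']; simp
    have hDs : (D : Matrix n n ℝ)ᴴ = D := by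
      rw [conjTranspose_eq_transpose_of_trivial]; exact D.2
    refine Subtype.ext (trace_conjTranspose_mul_self_eq_zero_iff.1 ?_)
    rw [hDs, htr]
  obtain ⟨Z, hZ⟩ := hsurj ⟨1, transpose_one⟩
  exact ⟨Z, Z.2, congrArg Subtype.val hZ⟩

theorem posDef_one_sub_smul {Z : Matrix n n ℝ} (hZ : Zᵀ = Z) {b c : ℝ}
    (hc : ∀ v, v ≠ 0 → v ⬝ᵥ Z *ᵥ v < c * (v ⬝ᵥ v)) (hb : 0 ≤ b) (hbc : b * c ≤ 1 / 2) :
    (1 - b • Z).PosDef := by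
  refine posDef_real_iff.2 ⟨by simp [hZ], fun v hv => ?_⟩
  have h1 := hc v hv
  have h2 : 0 < v ⬝ᵥ v := by
    simpa using (posDef_real_iff.1 (PosDef.one (n := n) (R := ℝ))).2 v hv
  simp only [sub_mulVec, one_mulVec, smul_mulVec, dotProduct_sub, dotProduct_smul, smul_eq_mul]
  nlinarith

/-- Continuation in the shift `a`: large shifts are stable with `Z = 1`. At the infimum `a₀` of the
stable shifts the solution `Z` of `a₀ • Z - lyap Z = 1` is positive definite, and it would certify
smaller shifts too unless `a₀ = 0`. -/
theorem NoNonnegEigenvalue.lyapStable (h : NoNonnegEigenvalue M N) : LyapStable M N := by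
  let Λ : Set ℝ := {a | 0 ≤ a ∧ LyapStable (M - (a / 2) • 1) N}
  have hΛne : Λ.Nonempty := by
    obtain ⟨k, hk, hkv⟩ := exists_quadraticForm_lt (lyap M N 1)
    refine ⟨k, hk.le, 1, PosDef.one, posDef_real_iff.2 ⟨?_, fun v hv => ?_⟩⟩
    · rw [transpose_neg, transpose_lyap, transpose_one]
    · have := hkv v hv
      rw [lyap_sub_smul_one, neg_sub, sub_mulVec, smul_mulVec, dotProduct_sub, dotProduct_smul,
        one_mulVec, smul_eq_mul]
      linarith
  have hΛbdd : BddBelow Λ := ⟨0, fun a ha => ha.1⟩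
  set a₀ := sInf Λ with ha₀
  have ha₀0 : 0 ≤ a₀ := le_csInf hΛne fun a ha => ha.1
  obtain ⟨Z, hZ, hZeq⟩ := h.exists_smul_sub_lyap_eq_one ha₀0
  obtain ⟨c, hc, hcv⟩ := exists_quadraticForm_lt Z
  obtain ⟨d, hd, hdv⟩ := exists_quadraticForm_lt (-Z)
  have hZpos : Z.PosDef := by
    -- The infimum need not be attained, so comparison is applied at a nearby stable `a`; the gap `1
    -- / (2 * d)` keeps `1 - (a - a₀) • (-Z)` positive definite.
    obtain ⟨a, haΛ, ha⟩ := exists_lt_of_csInf_lt hΛne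
      (show a₀ < a₀ + 1 / (2 * d) by have : 0 < 1 / (2 * d) := by positivity
                                     linarith)
    have haa₀ : a₀ ≤ a := csInf_le hΛbdd haΛ
    have h1 : (1 - (a - a₀) • (-Z)).PosDef := by
      refine posDef_one_sub_smul (by rw [transpose_neg, hZ]) hdv (by linarith) ?_
      have : a - a₀ ≤ 1 / (2 * d) := by linarith
      calc (a - a₀) * d ≤ 1 / (2 * d) * d := by gcongr
        _ = 1 / 2 := by field_simp
    have h2 : lyap (M - (a / 2) • 1) N (-Z) = 1 - (a - a₀) • (-Z) := by
      rw [lyap_sub_smul_one, ← hZeq, map_neg]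
      module
    have h3 : Z.PosSemidef := by
      rw [← neg_neg Z]
      exact haΛ.2.nonpos_of_lyap_nonneg (by rw [transpose_neg, hZ]) (h2 ▸ h1.posSemidef)
    refine posDef_of_lyap_neg (M := M - (a₀ / 2) • 1) (N := N) h3 ?_
    rw [lyap_sub_smul_one, neg_sub, hZeq]
    exact PosDef.one
  rcases ha₀0.eq_or_lt with h0 | hpos
  · refine ⟨Z, hZpos, ?_⟩
    rw [← h0, zero_smul, zero_sub] at hZeq
    rw [hZeq]
    exact PosDef.one
  · exfalso
    have hm : max 0 (a₀ - 1 / (2 * c)) < a₀ := max_lt hpos (by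
      have : 0 < 1 / (2 * c) := by positivity
      linarith)
    refine absurd (csInf_le hΛbdd ⟨le_max_left 0 (a₀ - 1 / (2 * c)), Z, hZpos, ?_⟩) (not_le.2 hm)
    set a := max 0 (a₀ - 1 / (2 * c))
    have h2 : -lyap (M - (a / 2) • 1) N Z = 1 - (a₀ - a) • Z := by
      rw [lyap_sub_smul_one, ← hZeq]
      module
    rw [h2]
    refine posDef_one_sub_smul hZ hcv (by linarith) ?_
    have : a₀ - a ≤ 1 / (2 * c) := by
      have := le_max_right 0 (a₀ - 1 / (2 * c))
      linarith
    calc (a₀ - a) * c ≤ 1 / (2 * c) * c := by gcongr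
      _ = 1 / 2 := by field_simp

end Matrix

/-! ### Hurwitz and exponential stability exclude nonnegative eigenvalues -/

theorem IsHurwitz.noNonnegEigenvalue {n : ℕ} {M : Matrix (Fin n) (Fin n) ℝ} (hM : IsHurwitz M)
    (N : Fin 0 → Matrix (Fin n) (Fin n) ℝ) : Matrix.NoNonnegEigenvalue M N := by
  intro a ha S hS h
  rcases isEmpty_or_nonempty (Fin n) with hn | hn
  · exact Subsingleton.elim _ _
  rw [Matrix.lyap_apply, Finset.univ_eq_empty, Finset.sum_empty, add_zero,
    Matrix.transpose_transpose] at h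
  let f : ℝ →+* ℂ := algebraMap ℝ ℂ
  let K := M.map f
  let T := S.map f
  -- Sylvester's argument: `T` intertwines `K` with `a - Kᵀ`, hence also polynomials in them. The
  -- characteristic polynomial of `K` kills `K` but is invertible at `a - Kᵀ`: a common eigenvalue
  -- `z` would put both `z` and `a - z` in the open left half-plane although `a ≥ 0`.
  have hT : K * T = T * ((a : ℂ) • 1 - Kᵀ) := by
    have h' := congrArg (fun X => X.map f) h
    simp only [Matrix.map_add f (map_add f), Matrix.map_mul] at h'
    have h2 : (a • S).map f = (a : ℂ) • T := by
      ext i j; simp [T, f]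
    have h3 : Mᵀ.map f = Kᵀ := rfl
    rw [h2, h3] at h'
    rw [Matrix.mul_sub, Matrix.mul_smul, Matrix.mul_one, ← h']
    exact (add_sub_cancel_right _ _).symm
  set V := (a : ℂ) • 1 - Kᵀ with hV
  have hpow (p : Polynomial ℂ) : Polynomial.aeval K p * T = T * Polynomial.aeval V p := by
    induction p using Polynomial.induction_on' with
    | add p q hp hq => simp only [map_add, Matrix.add_mul, Matrix.mul_add, hp, hq]
    | monomial k c =>
      have hk : K ^ k * T = T * V ^ k := by
        induction k with
        | zero => simp
        | succ k ih => rw [pow_succ, Matrix.mul_assoc, hT, ← Matrix.mul_assoc, ih,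
            Matrix.mul_assoc, ← pow_succ]
      rw [Polynomial.aeval_monomial, Polynomial.aeval_monomial, Matrix.mul_assoc, hk,
        ← Matrix.mul_assoc, ← Matrix.mul_assoc, Algebra.commutes]
  have h0 := hpow K.charpoly
  rw [Matrix.aeval_self_charpoly, Matrix.zero_mul] at h0
  have hunit : IsUnit (Polynomial.aeval V K.charpoly) := by
    rw [← spectrum.zero_notMem_iff ℂ,
      spectrum.map_polynomial_aeval_of_nonempty V K.charpoly
        (spectrum.nonempty_of_isAlgClosed_of_finiteDimensional ℂ V)]
    rintro ⟨z, hz, hz0⟩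
    have hzK : z ∈ spectrum ℂ K := Matrix.mem_spectrum_of_isRoot_charpoly hz0
    have hzV : (a : ℂ) - z ∈ spectrum ℂ K := by
      rw [spectrum.mem_iff] at hz ⊢
      intro hu
      apply hz
      rw [Algebra.algebraMap_eq_smul_one] at hu ⊢
      have : z • (1 : Matrix (Fin n) (Fin n) ℂ) - V = -(((a : ℂ) - z) • 1 - K)ᵀ := by
        rw [hV, Matrix.transpose_sub, Matrix.transpose_smul, Matrix.transpose_one]
        module
      rw [this]
      exact ((Matrix.isUnit_transpose _).2 hu).neg
    have h1 := hM z hzK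
    have h2 := hM _ hzV
    simp at h2
    linarith
  have hT0 : T = 0 := by
    obtain ⟨u, hu⟩ := hunit
    rw [← hu] at h0
    calc T = T * (u : Matrix (Fin n) (Fin n) ℂ) *
          ((u⁻¹ : (Matrix (Fin n) (Fin n) ℂ)ˣ) : Matrix _ _ ℂ) := by
          rw [Matrix.mul_assoc, Units.mul_inv, Matrix.mul_one]
      _ = 0 := by rw [← h0, Matrix.zero_mul]
  ext i j
  have := congrFun (congrFun hT0 i) j
  simpa [T, f] using this

section ExpStable
open scoped Matrix.Norms.Elementwise

theorem IsExpStable.noNonnegEigenvalue {n r : ℕ} {M : Matrix (Fin n) (Fin n) ℝ}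
    {N : Fin r → Matrix (Fin n) (Fin n) ℝ}
    (h : IsExpStable fun S => M * S + S * Mᵀ + ∑ i, N i * S * (N i)ᵀ) :
    Matrix.NoNonnegEigenvalue M N := by
  intro a ha S hS hSa
  obtain ⟨c, hc, μ, hμ, h⟩ := h
  simp only [Matrix.lyap_apply, Matrix.transpose_transpose] at hSa
  -- An eigenvector gives the solution `exp (a * t) • S`, which does not decay.
  have key := h (fun t => Real.exp (a * t) • S)
    (fun t => by rw [Matrix.IsSymm, Matrix.transpose_smul, hS]) (fun t => by
      have h1 : HasDerivAt (fun t : ℝ => Real.exp (a * t)) (Real.exp (a * t) * a) t := by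
        simpa using ((hasDerivAt_id t).const_mul a).exp
      have h2 : M * (Real.exp (a * t) • S) + (Real.exp (a * t) • S) * Mᵀ +
          ∑ i, N i * (Real.exp (a * t) • S) * (N i)ᵀ = (Real.exp (a * t) * a) • S := by
        rw [mul_smul, ← hSa]
        simp only [Matrix.mul_smul, Matrix.smul_mul, smul_add, Finset.smul_sum]
      simp only [h2]
      exact h1.smul_const S)
  by_contra hS0
  have hpos : 0 < ‖S‖ := norm_pos_iff.2 hS0
  have hle (t : ℝ) (ht : 0 ≤ t) : 1 ≤ c * Real.exp (-μ * t) := by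
    have h1 := key 0 t ht
    simp only [norm_smul, mul_zero, Real.exp_zero, one_mul, sub_zero, Real.norm_eq_abs,
      Real.abs_exp, abs_one] at h1
    have h2 := le_of_mul_le_mul_right h1 hpos
    exact (Real.one_le_exp (by positivity)).trans h2
  have hlim : Tendsto (fun t : ℝ => c * Real.exp (-μ * t)) atTop (𝓝 (c * 0)) :=
    (Real.tendsto_exp_atBot.comp (tendsto_id.const_mul_atTop_of_neg (neg_lt_zero.2 hμ))).const_mul c
  have := ge_of_tendsto hlim ((eventually_ge_atTop 0).mono fun t ht => hle t ht)
  norm_num at this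

end ExpStable

/-! ### Algebra of the Riccati function -/

namespace SCARE
open Matrix

variable {n m r : ℕ} (E : SCARE n m r)

/-- The closed-loop coefficients of the noise under the feedback `F`. -/
def closedA₀ (F : Matrix (Fin m) (Fin n) ℝ) (i : Fin r) : Matrix (Fin n) (Fin n) ℝ :=
  E.A₀ i + E.B₀ i * F

/-- The optimal feedback `-R_c(X)⁻¹ S(X)ᵀ`. -/
noncomputable def gain (X : Matrix (Fin n) (Fin n) ℝ) : Matrix (Fin m) (Fin n) ℝ :=
  -((E.Rc X)⁻¹ * (E.Sc X)ᵀ)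

/-- The closed-loop cost under the feedback `F`. -/
noncomputable def closedCost (F : Matrix (Fin m) (Fin n) ℝ) : Matrix (Fin n) (Fin n) ℝ :=
  (E.Q - E.L * E.R⁻¹ * E.Lᵀ) + (F + E.R⁻¹ * E.Lᵀ)ᵀ * E.R * (F + E.R⁻¹ * E.Lᵀ)

variable {E}

theorem hatA_eq (X : Matrix (Fin n) (Fin n) ℝ) : E.hatA X = E.A + E.B * E.gain X := by
  simp [hatA, gain, Matrix.mul_assoc, sub_eq_add_neg]

theorem Pc_eq (X : Matrix (Fin n) (Fin n) ℝ) : E.Pc X = fromRows 1 (E.gain X) := rfl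

theorem transpose_Pi12 {X : Matrix (Fin n) (Fin n) ℝ} (hX : Xᵀ = X) :
    (E.Pi12 X)ᵀ = E.Pi21 X := by
  simp [Pi12, Pi21, transpose_sum, transpose_mul, hX, Matrix.mul_assoc]

theorem transpose_Pi22 {X : Matrix (Fin n) (Fin n) ℝ} (hX : Xᵀ = X) :
    (E.Pi22 X)ᵀ = E.Pi22 X := by
  simp [Pi22, transpose_sum, transpose_mul, hX, Matrix.mul_assoc]

theorem transpose_fromRows_mul_fromBlocks_mul (F : Matrix (Fin m) (Fin n) ℝ)
    (a : Matrix (Fin n) (Fin n) ℝ) (b : Matrix (Fin n) (Fin m) ℝ) (c : Matrix (Fin m) (Fin n) ℝ)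
    (d : Matrix (Fin m) (Fin m) ℝ) (Y : Matrix (Fin n) (Fin n) ℝ) :
    (fromRows Y F)ᵀ * fromBlocks a b c d * fromRows Y F =
      Yᵀ * a * Y + Yᵀ * b * F + Fᵀ * c * Y + Fᵀ * d * F := by
  rw [transpose_fromRows, Matrix.mul_assoc, fromBlocks_mul_fromRows, fromCols_mul_fromRows]
  simp only [Matrix.mul_add, Matrix.mul_assoc]
  abel

theorem conj_Pi (F : Matrix (Fin m) (Fin n) ℝ) (X : Matrix (Fin n) (Fin n) ℝ) :
    (fromRows (1 : Matrix (Fin n) (Fin n) ℝ) F)ᵀ * E.Pi X *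
        fromRows (1 : Matrix (Fin n) (Fin n) ℝ) F =
      ∑ i, (E.closedA₀ F i)ᵀ * X * E.closedA₀ F i := by
  rw [Pi, transpose_fromRows_mul_fromBlocks_mul]
  simp only [Pi11, Pi12, Pi21, Pi22, closedA₀, transpose_one, Matrix.one_mul, Matrix.mul_one,
    Matrix.sum_mul, Matrix.mul_sum, Finset.sum_add_distrib, transpose_add, transpose_mul,
    Matrix.add_mul, Matrix.mul_add, Matrix.mul_assoc]
  abel

/-- Completing the square in `R` splits the cost into two positive semidefinite terms, from which
its null space can be read off. -/
theorem conj_cost (hR : E.R.PosDef) (F : Matrix (Fin m) (Fin n) ℝ) :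
    (fromRows (1 : Matrix (Fin n) (Fin n) ℝ) F)ᵀ * fromBlocks E.Q E.L E.Lᵀ E.R *
        fromRows (1 : Matrix (Fin n) (Fin n) ℝ) F =
      E.closedCost F := by
  have hu : IsUnit E.R.det := (isUnit_iff_isUnit_det _).1 hR.isUnit
  have hs : E.Rᵀ = E.R := (posDef_real_iff.1 hR).1
  rw [transpose_fromRows_mul_fromBlocks_mul, closedCost]
  simp only [transpose_one, Matrix.one_mul, Matrix.mul_one, transpose_add, transpose_mul,
    transpose_transpose, transpose_nonsing_inv, hs, Matrix.add_mul, Matrix.mul_add,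
    Matrix.mul_assoc, nonsing_inv_mul_cancel_left _ _ hu, mul_nonsing_inv_cancel_left _ _ hu]
  abel

theorem Rc_posDef (hR : E.R.PosDef) {X : Matrix (Fin n) (Fin n) ℝ} (hX : 0 ≤ X) :
    (E.Rc X).PosDef := by
  refine hR.add_posSemidef (posSemidef_sum _ fun i _ => ?_)
  simpa using (nonneg_iff_posSemidef.1 hX).conjTranspose_mul_mul_same (E.B₀ i)

/-- Completion of squares in the Riccati function. -/
theorem lyap_add_closedCost (hR : E.R.PosDef) {X : Matrix (Fin n) (Fin n) ℝ} (hX : 0 ≤ X)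
    (F : Matrix (Fin m) (Fin n) ℝ) :
    lyap (E.A + E.B * F) (E.closedA₀ F) X + E.closedCost F =
      E.riccati X + (F - E.gain X)ᵀ * E.Rc X * (F - E.gain X) := by
  have hXs : Xᵀ = X := (posSemidef_real_iff.1 (nonneg_iff_posSemidef.1 hX)).1
  have hRc := Rc_posDef hR hX
  have hu : IsUnit (E.Rc X).det := (isUnit_iff_isUnit_det _).1 hRc.isUnit
  have hs : (E.Rc X)ᵀ = E.Rc X := (posDef_real_iff.1 hRc).1
  rw [lyap_apply, ← conj_Pi, ← conj_cost hR, Pi, transpose_fromRows_mul_fromBlocks_mul,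
    transpose_fromRows_mul_fromBlocks_mul, riccati, gain]
  have hsq : (F - -((E.Rc X)⁻¹ * (E.Sc X)ᵀ))ᵀ * E.Rc X * (F - -((E.Rc X)⁻¹ * (E.Sc X)ᵀ)) =
      Fᵀ * E.Rc X * F + Fᵀ * (E.Sc X)ᵀ + E.Sc X * F + E.Sc X * (E.Rc X)⁻¹ * (E.Sc X)ᵀ := by
    simp only [sub_neg_eq_add, transpose_add, transpose_mul,
      transpose_transpose, transpose_nonsing_inv, hs, Matrix.add_mul, Matrix.mul_add,
      Matrix.mul_assoc, nonsing_inv_mul_cancel_left _ _ hu, mul_nonsing_inv_cancel_left _ _ hu]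
    abel
  rw [hsq]
  simp only [Sc, Lc, transpose_add, transpose_mul, transpose_Pi12 hXs, hXs, transpose_one,
    Matrix.one_mul, Matrix.mul_one, Matrix.add_mul, Matrix.mul_add, Matrix.mul_assoc]
  simp only [Rc, Matrix.add_mul, Matrix.mul_add]
  abel

theorem lyap_gain_add_closedCost (hR : E.R.PosDef) {X : Matrix (Fin n) (Fin n) ℝ} (hX : 0 ≤ X) :
    lyap (E.hatA X) (E.closedA₀ (E.gain X)) X + E.closedCost (E.gain X) = E.riccati X := by
  rw [hatA_eq, lyap_add_closedCost hR hX]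
  simp

theorem conj_Omega (W : Matrix (Fin n) (Fin n) ℝ)
    {Y : Matrix (Fin n) (Fin n) ℝ} (hY : Yᵀ = Y) :
    (fromRows Y (-1 : Matrix (Fin n) (Fin n) ℝ))ᵀ * E.Omega W *
      fromRows Y (-1 : Matrix (Fin n) (Fin n) ℝ) = (E.Ac W)ᵀ * Y + Y * E.Ac W + E.Hc W
        - Y * E.Gc W * Y := by
  rw [Omega, transpose_fromRows, Matrix.mul_assoc, fromBlocks_mul_fromRows, fromCols_mul_fromRows]
  simp only [hY, transpose_neg, transpose_one, Matrix.mul_add, Matrix.mul_neg, Matrix.neg_mul,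
    Matrix.mul_one, Matrix.one_mul, neg_neg, ← Matrix.mul_assoc]
  abel

/-- Compressing `Ω(Y)` by `[Y; -I]` gives `ℛ(Y)`. Compressing `Ω(W)` instead gives a Riccati
function with coefficients frozen at `W`, which is quadratic in `Y` and expands exactly around `W`.
-/
theorem bigF_eq (hR : E.Rᵀ = E.R) {W Y : Matrix (Fin n) (Fin n) ℝ} (hW : Wᵀ = W) (hY : Yᵀ = Y) :
    E.bigF W Y = E.riccati Y - (E.riccati W + (E.hatA W)ᵀ * (Y - W) + (Y - W) * E.hatA W
      - (Y - W) * E.Gc W * (Y - W)) := by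
  have hs {X : Matrix (Fin n) (Fin n) ℝ} (hX : Xᵀ = X) : (E.Rc X)ᵀ = E.Rc X := by
    rw [Rc, transpose_add, hR, transpose_Pi22 hX]
  rw [bigF, Matrix.mul_sub, Matrix.sub_mul, conj_Omega Y hY, conj_Omega W hY]
  simp only [riccati, Ac, Gc, Hc, Qc, Sc, hatA, transpose_add, transpose_sub, transpose_mul,
    transpose_transpose, transpose_nonsing_inv, hs hW, hs hY, hW, hY, Matrix.add_mul,
    Matrix.mul_add, Matrix.sub_mul, Matrix.mul_sub, Matrix.mul_assoc]
  abel

end SCARE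

/-! ### Limits and inverses in the Loewner order -/

namespace Matrix

variable {n : Type*} [Fintype n]

theorem tendsto_quadraticForm {X : ℕ → Matrix n n ℝ} {L : Matrix n n ℝ}
    (h : Tendsto X atTop (𝓝 L)) (v : n → ℝ) :
    Tendsto (fun k => v ⬝ᵥ X k *ᵥ v) atTop (𝓝 (v ⬝ᵥ L *ᵥ v)) := by
  have hc : Continuous fun Z : Matrix n n ℝ => v ⬝ᵥ Z *ᵥ v :=
    continuous_const.dotProduct (continuous_id.matrix_mulVec continuous_const)
  exact (hc.tendsto L).comp h

theorem PosSemidef.of_tendsto {X : ℕ → Matrix n n ℝ} {L : Matrix n n ℝ}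
    (h : Tendsto X atTop (𝓝 L)) (hX : ∀ k, (X k).PosSemidef) : L.PosSemidef := by
  refine posSemidef_real_iff.2 ⟨?_, fun v => ?_⟩
  · have h1 : Tendsto (fun k => (X k)ᵀ) atTop (𝓝 Lᵀ) :=
      (continuous_id.matrix_transpose.tendsto L).comp h
    simp only [fun k => (posSemidef_real_iff.1 (hX k)).1] at h1
    exact tendsto_nhds_unique h1 h
  · exact ge_of_tendsto' (tendsto_quadraticForm h v) fun k => (posSemidef_real_iff.1 (hX k)).2 v

/-- Each quadratic form is monotone and bounded; polarization recovers the entries. -/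
theorem exists_tendsto_of_monotone [DecidableEq n] {X : ℕ → Matrix n n ℝ} {B : Matrix n n ℝ}
    (h0 : ∀ k, 0 ≤ X k) (hmono : ∀ k, X k ≤ X (k + 1)) (hB : ∀ k, X k ≤ B) :
    ∃ L, Tendsto X atTop (𝓝 L) := by
  have hle {Y Z : Matrix n n ℝ} (h : Y ≤ Z) (v : n → ℝ) : v ⬝ᵥ Y *ᵥ v ≤ v ⬝ᵥ Z *ᵥ v := by
    have := (posSemidef_real_iff.1 (le_iff.1 h)).2 v
    rw [sub_mulVec, dotProduct_sub] at this
    linarith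
  have hq (v : n → ℝ) : ∃ l, Tendsto (fun k => v ⬝ᵥ X k *ᵥ v) atTop (𝓝 l) := by
    refine ⟨_, tendsto_atTop_ciSup (monotone_nat_of_le_succ fun k => hle (hmono k) v)
      ⟨v ⬝ᵥ B *ᵥ v, ?_⟩⟩
    rintro _ ⟨k, rfl⟩
    exact hle (hB k) v
  choose l hl using hq
  let e (i : n) : n → ℝ := Pi.single i 1
  have hij (i j : n) (k : ℕ) : X k i j = ((e i + e j) ⬝ᵥ X k *ᵥ (e i + e j)
      - e i ⬝ᵥ X k *ᵥ e i - e j ⬝ᵥ X k *ᵥ e j) / 2 := by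
    have hs : X k j i = X k i j :=
      congrFun (congrFun (posSemidef_real_iff.1 (nonneg_iff_posSemidef.1 (h0 k))).1 i) j
    simp only [e, mulVec_add, dotProduct_add, add_dotProduct, mulVec_single_one,
      single_one_dotProduct, col_apply, hs]
    ring
  refine ⟨of fun i j => (l (e i + e j) - l (e i) - l (e j)) / 2, ?_⟩
  refine tendsto_pi_nhds.2 fun i => tendsto_pi_nhds.2 fun j => ?_
  simp only [hij i j]
  exact (((hl _).sub (hl _)).sub (hl _)).div_const 2

theorem _root_.ContinuousAt.matrix_mul' {T l m p : Type*} [TopologicalSpace T] [Fintype m]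
    {f : T → Matrix l m ℝ} {g : T → Matrix m p ℝ} {x : T} (hf : ContinuousAt f x)
    (hg : ContinuousAt g x) : ContinuousAt (fun y => f y * g y) x :=
  (continuous_fst.matrix_mul continuous_snd).continuousAt.comp (hf.prodMk hg)

variable [DecidableEq n]

/-- Both Schur complements of the block matrix `[R⁻¹, 1; 1, R + P]` are used: one is `P`, the other
the claimed difference. -/
theorem PosDef.posSemidef_inv_sub_inv {R P : Matrix n n ℝ} (hR : R.PosDef) (hP : P.PosSemidef) :
    (R⁻¹ - (R + P)⁻¹).PosSemidef := by
  have hS := hR.add_posSemidef hP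
  let := hR.inv.isUnit.invertible
  let := hS.isUnit.invertible
  have hu : IsUnit R.det := (isUnit_iff_isUnit_det _).1 hR.isUnit
  have h := (PosDef.fromBlocks₁₁ (1 : Matrix n n ℝ) (R + P) hR.inv).2 (by
    simpa [nonsing_inv_nonsing_inv _ hu] using hP)
  simpa using (PosDef.fromBlocks₂₂ R⁻¹ (1 : Matrix n n ℝ) hS).1 h

theorem PosDef.continuousAt_inv {R : Matrix n n ℝ} (hR : R.PosDef) :
    ContinuousAt (Inv.inv : Matrix n n ℝ → Matrix n n ℝ) R := by
  refine continuousAt_matrix_inv R ?_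
  rw [Ring.inverse_eq_inv']
  exact continuousAt_inv₀ ((isUnit_iff_isUnit_det _).1 hR.isUnit).ne_zero

end Matrix

/-! ### Stability of the closed loops and comparison of solutions -/

namespace SCARE
open Matrix

variable {n m r : ℕ} {E : SCARE n m r}

theorem posSemidef_reducedCost (hR : E.R.PosDef)
    (hc : (fromBlocks E.Q E.L E.Lᵀ E.R).PosSemidef) :
    (E.Q - E.L * E.R⁻¹ * E.Lᵀ).PosSemidef := by
  let := hR.isUnit.invertible
  simpa using (PosDef.fromBlocks₂₂ E.Q E.L hR).1 (by simpa using hc)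

theorem posSemidef_conj (hR : E.R.PosDef) (F : Matrix (Fin m) (Fin n) ℝ) :
    (Fᵀ * E.R * F).PosSemidef := by
  simpa using hR.posSemidef.conjTranspose_mul_mul_same F

theorem posSemidef_closedCost (hE : E.Standing) (F : Matrix (Fin m) (Fin n) ℝ) :
    (E.closedCost F).PosSemidef :=
  (posSemidef_reducedCost hE.posDef_R hE.posSemidef_cost).add (posSemidef_conj hE.posDef_R _)

theorem closedCost_mulVec_eq_zero (hE : E.Standing) {F : Matrix (Fin m) (Fin n) ℝ}
    {v : Fin n → ℝ} (hv : E.closedCost F *ᵥ v = 0) :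
    (E.Q - E.L * E.R⁻¹ * E.Lᵀ) *ᵥ v = 0 ∧ F *ᵥ v = -((E.R⁻¹ * E.Lᵀ) *ᵥ v) := by
  have hQ := posSemidef_reducedCost hE.posDef_R hE.posSemidef_cost
  set G := F + E.R⁻¹ * E.Lᵀ with hG
  have hGG := posSemidef_conj hE.posDef_R G
  have h0 : v ⬝ᵥ E.closedCost F *ᵥ v = 0 := by rw [hv, dotProduct_zero]
  rw [closedCost, add_mulVec, dotProduct_add] at h0
  have h1 := (posSemidef_real_iff.1 hQ).2 v
  have h2 := (posSemidef_real_iff.1 hGG).2 v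
  refine ⟨(hQ.dotProduct_mulVec_zero_iff v).1 (by rw [star_trivial]; linarith), ?_⟩
  have h3 : v ⬝ᵥ (Gᵀ * E.R * G) *ᵥ v = (G *ᵥ v) ⬝ᵥ E.R *ᵥ (G *ᵥ v) := by
    rw [← mulVec_mulVec, ← mulVec_mulVec, mulVec_transpose, dotProduct_comm, ← dotProduct_mulVec,
      dotProduct_comm]
  have h4 : G *ᵥ v = 0 := by
    by_contra hne
    have := (posDef_real_iff.1 hE.posDef_R).2 _ hne
    linarith
  rw [hG, add_mulVec] at h4
  exact eq_neg_of_add_eq_zero_left h4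

/-- A positive semidefinite solution of the Riccati equation is stochastically stabilizing. -/
theorem IsPSDSolution.lyapStable (hE : E.Standing) {X : Matrix (Fin n) (Fin n) ℝ}
    (hX : E.IsPSDSolution X) : LyapStable (E.hatA X) (E.closedA₀ (E.gain X)) := by
  obtain ⟨p, C, hC, K, hK⟩ := hE.stochDetectable
  have hH := posSemidef_closedCost hE (E.gain X)
  refine LyapStable.of_detectable (nonneg_iff_posSemidef.1 hX.1) hH ?_
    hK.noNonnegEigenvalue.lyapStable fun v hv => ?_
  · have h := lyap_gain_add_closedCost hE.posDef_R hX.1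
    rw [hX.2] at h
    rw [eq_neg_of_add_eq_zero_left h, sub_neg_eq_add, neg_add_cancel]
    exact PosSemidef.zero
  · obtain ⟨h1, h2⟩ := closedCost_mulVec_eq_zero hE hv
    -- On the kernel of the closed-loop cost the injection `K * C` vanishes and the feedback equals
    -- `-R⁻¹ Lᵀ`, so the closed loop agrees there with the detectability system.
    have hCv : C *ᵥ v = 0 := by
      rw [← hC] at h1
      exact (conjTranspose_mul_self_mulVec_eq_zero C v).1 (by simpa using h1)
    have hB {l : ℕ} (B : Matrix (Fin l) (Fin m) ℝ) :
        (B * E.gain X) *ᵥ v = -((B * E.R⁻¹ * E.Lᵀ) *ᵥ v) := by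
      rw [← mulVec_mulVec, h2, mulVec_neg, mulVec_mulVec, Matrix.mul_assoc]
    refine ⟨?_, fun i => ?_⟩
    · rw [hatA_eq, tildeA, add_mulVec, add_mulVec, sub_mulVec, hB, ← mulVec_mulVec v K C, hCv,
        mulVec_zero, add_zero, sub_eq_add_neg]
    · rw [closedA₀, tildeA₀, add_mulVec, sub_mulVec, hB, sub_eq_add_neg]

/-- The `Π` term is frozen at `X`, so it cancels against the one in `ℛ(X)` and a deterministic
Lyapunov equation for the correction remains. -/
theorem IsModifiedNewtonStep.lyap_sub (hR : E.R.PosDef) {X X' : Matrix (Fin n) (Fin n) ℝ}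
    (hX : 0 ≤ X) (h : E.IsModifiedNewtonStep X X') (N : Fin 0 → Matrix (Fin n) (Fin n) ℝ) :
    lyap (E.hatA X) N (X' - X) = -E.riccati X := by
  have h1 := lyap_gain_add_closedCost hR hX
  rw [IsModifiedNewtonStep, Pc_eq, conj_Pi, conj_cost hR] at h
  rw [lyap_apply] at h1
  rw [lyap_apply, Finset.univ_eq_empty, Finset.sum_empty, add_zero, ← h1, ← sub_eq_zero, ← h]
  simp only [Matrix.mul_sub, Matrix.sub_mul]
  abel

/-- The modified Newton closed loop is stable as soon as the next iterate is positive
semidefinite. -/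
theorem IsModifiedNewtonStep.lyapStable (hE : E.Standing) {X X' : Matrix (Fin n) (Fin n) ℝ}
    (hX : 0 ≤ X) (hX' : 0 ≤ X') (h : E.IsModifiedNewtonStep X X')
    (N : Fin 0 → Matrix (Fin n) (Fin n) ℝ) : LyapStable (E.hatA X) N := by
  obtain ⟨K, hK⟩ := hE.detectable
  have hH := posSemidef_closedCost hE (E.gain X)
  refine LyapStable.of_detectable (N' := N) (nonneg_iff_posSemidef.1 hX') hH ?_
    (hK.noNonnegEigenvalue N).lyapStable fun v hv => ⟨?_, fun i => rfl⟩
  · rw [IsModifiedNewtonStep, Pc_eq, conj_Pi, conj_cost hE.posDef_R] at h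
    have : -E.closedCost (E.gain X) - lyap (E.hatA X) N X' =
        ∑ i, (E.closedA₀ (E.gain X) i)ᵀ * X * E.closedA₀ (E.gain X) i := by
      rw [lyap_apply, Finset.univ_eq_empty, Finset.sum_empty, add_zero, ← sub_eq_zero, ← neg_eq_zero,
        ← h]
      abel
    rw [this]
    refine posSemidef_sum _ fun i _ => ?_
    simpa using (nonneg_iff_posSemidef.1 hX).conjTranspose_mul_mul_same (E.closedA₀ (E.gain X) i)
  · obtain ⟨h1, h2⟩ := closedCost_mulVec_eq_zero hE hv
    -- Detectability is assumed for `A`, not `Ã`; the null space condition gives `Lᵀ v = 0`, so the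
    -- feedback vanishes at `v`.
    have hL := (hE.ker_subset v h1).1
    rw [hatA_eq, add_mulVec, add_mulVec, ← mulVec_mulVec, ← mulVec_mulVec, h1, h2,
      ← mulVec_mulVec, hL]
    simp

/-- The Riccati function dominates its modified linearization. -/
theorem riccati_add_lyap_le (hR : E.R.PosDef) {W Y : Matrix (Fin n) (Fin n) ℝ} (hW : 0 ≤ W)
    (hY : 0 ≤ Y) (N : Fin 0 → Matrix (Fin n) (Fin n) ℝ)
    (h : 0 ≤ E.bigF W Y - (Y - W) * (E.B * E.R⁻¹ * E.Bᵀ) * (Y - W)) :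
    E.riccati W + lyap (E.hatA W) N (Y - W) ≤ E.riccati Y := by
  have hWp := nonneg_iff_posSemidef.1 hW
  have hWs := (posSemidef_real_iff.1 hWp).1
  have hYs := (posSemidef_real_iff.1 (nonneg_iff_posSemidef.1 hY)).1
  have hP : (E.Pi22 W).PosSemidef := posSemidef_sum _ fun i _ => by
    simpa using hWp.conjTranspose_mul_mul_same (E.B₀ i)
  -- The hypothesis involves `R⁻¹`, the expansion `R_c(W)⁻¹`; this term is the difference.
  have h1 := (hR.posSemidef_inv_sub_inv hP).mul_mul_conjTranspose_same ((Y - W) * E.B)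
  have h2 := (nonneg_iff_posSemidef.1 h).add h1
  rw [le_iff]
  convert h2 using 1
  rw [bigF_eq (posDef_real_iff.1 hR).1 hWs hYs, lyap_apply, Finset.univ_eq_empty,
    Finset.sum_empty, add_zero, conjTranspose_eq_transpose_of_trivial, transpose_mul,
    transpose_sub, hWs, hYs, Gc, Rc, Matrix.mul_sub ((Y - W) * E.B),
    Matrix.sub_mul ((Y - W) * E.B * E.R⁻¹)]
  simp only [Matrix.mul_assoc]
  abel

theorem continuousAt_Rc_inv (hR : E.R.PosDef) {L : Matrix (Fin n) (Fin n) ℝ} (hL : 0 ≤ L) :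
    ContinuousAt (fun X => (E.Rc X)⁻¹) L := by
  have hc : Continuous E.Rc := by
    unfold Rc Pi22
    fun_prop
  exact (Rc_posDef hR hL).continuousAt_inv.comp hc.continuousAt

theorem continuous_Sc : Continuous E.Sc := by
  unfold Sc Lc Pi12
  fun_prop

theorem continuousAt_riccati (hR : E.R.PosDef) {L : Matrix (Fin n) (Fin n) ℝ} (hL : 0 ≤ L) :
    ContinuousAt E.riccati L := by
  have h1 : Continuous fun X => E.Aᵀ * X + X * E.A + E.Q + E.Pi11 X := by
    unfold Pi11
    fun_prop
  exact h1.continuousAt.sub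
    ((continuous_Sc.continuousAt.matrix_mul' (continuousAt_Rc_inv hR hL)).matrix_mul'
    continuous_Sc.matrix_transpose.continuousAt)

theorem continuousAt_hatA (hR : E.R.PosDef) {L : Matrix (Fin n) (Fin n) ℝ} (hL : 0 ≤ L) :
    ContinuousAt E.hatA L :=
  continuousAt_const.sub ((continuousAt_const.matrix_mul' (continuousAt_Rc_inv hR hL)).matrix_mul'
    continuous_Sc.matrix_transpose.continuousAt)

/-- Under the gain of `X`, completion of squares leaves a nonnegative square for `Y` and none for
`X`, so the stable closed loop of `X` forces `Y - X ≤ 0`. -/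
theorem IsPSDSolution.eq_of_le (hE : E.Standing) {X Y : Matrix (Fin n) (Fin n) ℝ}
    (hX : E.IsPSDSolution X) (hY : E.IsPSDSolution Y) (hXY : X ≤ Y) : X = Y := by
  have h1 := lyap_gain_add_closedCost hE.posDef_R hX.1
  have h2 := lyap_add_closedCost hE.posDef_R hY.1 (E.gain X)
  rw [← hatA_eq, hY.2, zero_add] at h2
  rw [hX.2] at h1
  have h3 : (lyap (E.hatA X) (E.closedA₀ (E.gain X)) (Y - X)).PosSemidef := by
    have h4 : lyap (E.hatA X) (E.closedA₀ (E.gain X)) (Y - X) =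
        (E.gain X - E.gain Y)ᵀ * E.Rc Y * (E.gain X - E.gain Y) := by
      rw [map_sub, ← h2, eq_neg_of_add_eq_zero_left h1]
      abel
    rw [h4]
    simpa using (Rc_posDef hE.posDef_R hY.1).posSemidef.conjTranspose_mul_mul_same
      (E.gain X - E.gain Y)
  have hD := (posSemidef_real_iff.1 (le_iff.1 hXY)).1
  refine le_antisymm hXY (le_iff.2 ?_)
  rw [← neg_sub Y X]
  exact (hX.lyapStable hE).nonpos_of_lyap_nonneg hD h3

end SCARE

/-! ### Monotone convergence of the modified Newton method -/

open Matrix in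
theorem mainTheorem5 {n m r : ℕ} (E : SCARE n m r) (hE : E.Standing)
    (Xs : Matrix (Fin n) (Fin n) ℝ) (hXs : E.IsPSDSolution Xs)
    (hα : ∃ α : ℝ, 0 < α ∧ ∀ Z : Matrix (Fin n) (Fin n) ℝ, 0 ≤ Z → α • Z ≤ E.scrF Xs Z)
    (X : ℕ → Matrix (Fin n) (Fin n) ℝ)
    (hX0 : 0 ≤ X 0) (hX0s : X 0 ≤ Xs)
    (hclose : ∀ W Y : Matrix (Fin n) (Fin n) ℝ, X 0 ≤ W → W ≤ Y → Y ≤ Xs →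
      0 ≤ E.bigF W Y - (Y - W) * (E.B * E.R⁻¹ * E.Bᵀ) * (Y - W))
    (hRX0 : 0 ≤ E.riccati (X 0))
    (hstep : ∀ k, E.IsModifiedNewtonStep (X k) (X (k + 1)))
    (hpsd : ∀ k, 0 ≤ X k) :
    (0 ≤ X 0 ∧ ∀ k, X k ≤ X (k + 1) ∧ X k ≤ Xs ∧ 0 ≤ E.riccati (X k)) ∧
      Tendsto X atTop (𝓝 Xs) := by
  have hR := hE.posDef_R
  -- The empty family makes `lyap` the deterministic Lyapunov operator.
  let N : Fin 0 → Matrix (Fin n) (Fin n) ℝ := Fin.elim0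
  have hsymm (k : ℕ) : (X k)ᵀ = X k := (posSemidef_real_iff.1 (nonneg_iff_posSemidef.1 (hpsd k))).1
  have hXss : Xsᵀ = Xs := (posSemidef_real_iff.1 (nonneg_iff_posSemidef.1 hXs.1)).1
  have hstab (k : ℕ) := (hstep k).lyapStable hE (hpsd k) (hpsd (k + 1)) N
  have hlyap (k : ℕ) := (hstep k).lyap_sub hR (hpsd k) N
  have hincr (k : ℕ) (hk : 0 ≤ E.riccati (X k)) : X k ≤ X (k + 1) := by
    rw [le_iff, ← neg_sub]
    refine (hstab k).nonpos_of_lyap_nonneg (by rw [transpose_sub, hsymm, hsymm]) ?_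
    rw [← neg_sub, map_neg, hlyap, neg_neg]
    exact nonneg_iff_posSemidef.1 hk
  have main (k : ℕ) : X 0 ≤ X k ∧ X k ≤ Xs ∧ 0 ≤ E.riccati (X k) := by
    induction k with
    | zero => exact ⟨le_rfl, hX0s, hRX0⟩
    | succ k ih =>
      obtain ⟨h0, hs, hr⟩ := ih
      have hinc := hincr k hr
      have hle : X (k + 1) ≤ Xs := by
        have h1 := SCARE.riccati_add_lyap_le hR (hpsd k) hXs.1 N (hclose _ _ h0 hs le_rfl)
        rw [hXs.2, le_iff, zero_sub] at h1
        rw [le_iff, ← neg_sub]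
        refine (hstab k).nonpos_of_lyap_nonneg (by rw [transpose_sub, hsymm, hXss]) ?_
        have h2 : lyap (E.hatA (X k)) N (X (k + 1) - Xs) =
            -(E.riccati (X k) + lyap (E.hatA (X k)) N (Xs - X k)) := by
          rw [← sub_sub_sub_cancel_right (X (k + 1)) Xs (X k), map_sub, hlyap]
          abel
        rw [h2]
        exact h1
      refine ⟨h0.trans hinc, hle, ?_⟩
      have h1 := SCARE.riccati_add_lyap_le hR (hpsd k) (hpsd (k + 1)) N (hclose _ _ h0 hinc hle)
      rwa [hlyap, add_neg_cancel] at h1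
  refine ⟨⟨hX0, fun k => ⟨hincr k (main k).2.2, (main k).2⟩⟩, ?_⟩
  obtain ⟨L, hL⟩ := exists_tendsto_of_monotone hpsd (fun k => hincr k (main k).2.2)
    fun k => (main k).2.1
  have hL0 : 0 ≤ L :=
    nonneg_iff_posSemidef.2 (PosSemidef.of_tendsto hL fun k => nonneg_iff_posSemidef.1 (hpsd k))
  have hLs : L ≤ Xs :=
    le_iff.2 (PosSemidef.of_tendsto (hL.const_sub Xs) fun k => le_iff.1 (main k).2.1)
  -- The corrections tend to zero while `hatA (X k)` converges, so the Lyapunov equation for the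
  -- correction passes to `ℛ(L) = 0`.
  have hLr : E.riccati L = 0 := by
    have hA : Tendsto (fun k => E.hatA (X k)) atTop (𝓝 (E.hatA L)) :=
      (SCARE.continuousAt_hatA hR hL0).tendsto.comp hL
    have hr : Tendsto (fun k => E.riccati (X k)) atTop (𝓝 (E.riccati L)) :=
      (SCARE.continuousAt_riccati hR hL0).tendsto.comp hL
    have hD : Tendsto (fun k => X (k + 1) - X k) atTop (𝓝 0) := by
      simpa using (hL.comp (tendsto_add_atTop_nat 1)).sub hL
    have hAT : Tendsto (fun k => (E.hatA (X k))ᵀ) atTop (𝓝 (E.hatA L)ᵀ) :=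
      (continuous_id.matrix_transpose.tendsto _).comp hA
    have h1 := ((hAT.mul hD).add (hD.mul hA)).add hr
    have h2 (k : ℕ) : (E.hatA (X k))ᵀ * (X (k + 1) - X k) + (X (k + 1) - X k) * E.hatA (X k)
        + E.riccati (X k) = 0 := by
      have := hlyap k
      rw [lyap_apply, Finset.univ_eq_empty, Finset.sum_empty, add_zero] at this
      rw [this, neg_add_cancel]
    simp only [h2, Matrix.mul_zero, Matrix.zero_mul, zero_add] at h1
    exact (tendsto_nhds_unique tendsto_const_nhds h1).symm
  rwa [← SCARE.IsPSDSolution.eq_of_le hE ⟨hL0, hLr⟩ hXs hLs]
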